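/- Let $k$ be a field. For $n \ge 1$ let $\mathcal S(n)$ be the category of triples $(V,U,T)$, where $V$ is a finite-dimensional $k$-vector space, $T\colon V\to V$ is a $k$-linear operator with $T^n=0$, and $U\subseteq V$ is a subspace with $T(U)\subseteq U$; a morphism $(V,U,T)\to(V',U',T')$ is a $k$-linear map $g\colon V\to V'$ with $g(U)\subseteq U'$ and $gT=T'g$. A triple is indecomposable if it is non-zero and not isomorphic to a direct sum $(V_1\oplus V_2,\,U_1\oplus U_2,\,T_1\oplus T_2)$ of two non-zero triples. The dimension pair of $(V,U,T)$ is $(\dim V,\dim U)$. A strip in $\mathbb R^2$ is a region $\{(x,y) : c\le ax+by\le d\}$ between two parallel lines, with $a,b,c,d\in\mathbb R$ and $(a,b)\ne(0,0)$. (1) For every $n\ge 7$, the set of dimension pairs of the indecomposable triples in $\mathcal S(n)$ is not contained in any strip. (2) For every integer $f>0$ there are indecomposable triples in $\mathcal S(7)$ with dimension pair $f\cdot(13,6)$ and with dimension pair $f\cdot(13,7)$. -/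

import Mathlib

universe u

namespace NilpotentTriples

/-- An object `(V, U, T)` of the category `S_k(n)`: a finite-dimensional `k`-space `V`, a linear
operator `T` on `V` with `T ^ n = 0`, and a `T`-invariant subspace `U` of `V`. -/
structure Triple (k : Type u) [Field k] (n : ℕ) where
  V : Type u
  [addCommGroup : AddCommGroup V]
  [module : Module k V]
  [finite : FiniteDimensional k V]
  T : V →ₗ[k] V
  U : Submodule k V
  pow_eq_zero : T ^ n = 0
  invariant : ∀ x ∈ U, T x ∈ U

attribute [instance] Triple.addCommGroup Triple.module Triple.finite

variable {k : Type u} [Field k] {n : ℕ}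

/-- A morphism of triples: a linear map `f : V → V'` with `f(U) ⊆ U'` and `f T = T' f`. -/
def IsHom (X Y : Triple k n) (f : X.V →ₗ[k] Y.V) : Prop :=
  (∀ x ∈ X.U, f x ∈ Y.U) ∧ ∀ x, f (X.T x) = Y.T (f x)

/-- Two triples are isomorphic if there is a bijective linear map which is a morphism of triples
and whose inverse is a morphism of triples. -/
def Isomorphic (X Y : Triple k n) : Prop :=
  ∃ e : X.V ≃ₗ[k] Y.V, IsHom X Y e.toLinearMap ∧ IsHom Y X e.symm.toLinearMap

/-- A triple is zero if its total space is zero. -/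
def IsZero (X : Triple k n) : Prop := Subsingleton X.V

/-- Powers of `T ⊕ T'` are computed componentwise. -/
theorem prodMap_pow {V W : Type u} [AddCommGroup V] [Module k V] [AddCommGroup W] [Module k W]
    (T : V →ₗ[k] V) (S : W →ₗ[k] W) (m : ℕ) :
    (T.prodMap S) ^ m = (T ^ m).prodMap (S ^ m) := by
  induction m with
  | zero => ext <;> simp
  | succ m ih => rw [pow_succ, ih, pow_succ, pow_succ]; ext <;> simp

/-- The direct sum `(V ⊕ V', U ⊕ U', T ⊕ T')`. -/
def directSum (X Y : Triple k n) : Triple k n where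
  V := X.V × Y.V
  T := X.T.prodMap Y.T
  U := X.U.prod Y.U
  pow_eq_zero := by rw [prodMap_pow, X.pow_eq_zero, Y.pow_eq_zero]; ext <;> simp
  invariant := fun x hx => ⟨X.invariant _ hx.1, Y.invariant _ hx.2⟩

/-- A triple is indecomposable if it is not zero and not isomorphic to a direct sum of two
non-zero triples. -/
def Indecomposable (X : Triple k n) : Prop :=
  ¬ IsZero X ∧
    ¬ ∃ Y Z : Triple k n, ¬ IsZero Y ∧ ¬ IsZero Z ∧ Isomorphic X (directSum Y Z)

/-- The dimension pair `(dim V, dim U)`. -/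
noncomputable def dimPair (X : Triple k n) : ℕ × ℕ :=
  (Module.finrank k X.V, Module.finrank k X.U)

end NilpotentTriples

/-- A strip in the plane: the region between two parallel lines (of arbitrary slope). -/
def IsStrip (S : Set (ℝ × ℝ)) : Prop :=
  ∃ a b c d : ℝ, (a, b) ≠ (0, 0) ∧
    S = {p : ℝ × ℝ | c ≤ a * p.1 + b * p.2 ∧ a * p.1 + b * p.2 ≤ d}

/-! ### Idempotent endomorphisms and indecomposability -/

namespace NilpotentTriples

variable {k : Type u} [Field k] {n : ℕ}

/-! Take `V = M ^ 13` with `M = k ^ f`, where `T` has three columns of lengths 7, 4 and 2, graded so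
that each shorter column lies strictly inside the longer ones. A degree-preserving map between
different columns that commutes with `T` is then zero: a longer column has its generator above the
shorter one, and a shorter one has its bottom killed by `T` where the longer one continues. So the
degree-preserving part of an endomorphism is a triple of operators on `M`, one per column
(`entry_cross_eq_zero`, `entry_diag`).

In one degree where all three columns are present, `U` is the diagonal of `M ^ 3`, which forces the
three operators to equal a single `A`. One degree lower, `U` is the sum of the diagonal and all `(0,
w, J w)`, with `J` the Jordan block, which forces `A J = J A`. For an idempotent endomorphism `A` is
idempotent, hence `0` or `1` (`idempotent_commute_jordan`), and this determines the endomorphism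
(`eq_zero_or_id`).

There are two positions for the shorter columns, giving the slopes `6 / 13` and `7 / 13`. A strip
containing all multiples of both vectors would have `(a, b)` orthogonal to both, which are linearly
independent. -/

/-- A non-zero triple whose only idempotent endomorphisms are `0` and `1` is indecomposable. -/
theorem indecomposable_of_idempotent {X : Triple k n} (h0 : ¬ IsZero X)
    (h : ∀ e : X.V →ₗ[k] X.V, IsHom X X e → (∀ x, e (e x) = e x) → e = 0 ∨ e = LinearMap.id) :
    Indecomposable X := by
  refine ⟨h0, ?_⟩
  rintro ⟨Y, Z, hY, hZ, φ, hφ, hψ⟩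
  let e : X.V →ₗ[k] X.V :=
    φ.symm.toLinearMap ∘ₗ (LinearMap.inl k Y.V Z.V ∘ₗ LinearMap.fst k Y.V Z.V) ∘ₗ φ.toLinearMap
  have e_apply : ∀ x, e x = φ.symm ((φ x).1, 0) := fun _ => rfl
  have he : IsHom X X e := by
    refine ⟨fun x hx => ?_, fun x => ?_⟩
    · exact hψ.1 _ ⟨(hφ.1 x hx).1, Z.U.zero_mem⟩
    · have h1 : φ (X.T x) = (Y.T (φ x).1, Z.T (φ x).2) := hφ.2 x
      have h2 : φ.symm (Y.T (φ x).1, Z.T 0) = X.T (φ.symm ((φ x).1, 0)) := hψ.2 ((φ x).1, 0)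
      rw [e_apply, e_apply, h1, ← h2, map_zero]
  have hidem : ∀ x, e (e x) = e x := fun x => by
    rw [e_apply, e_apply]
    erw [LinearEquiv.apply_symm_apply φ]
  rcases h e he hidem with h | h
  · refine hY ⟨fun a b => ?_⟩
    have key : ∀ y : Y.V, y = 0 := fun y => by
      have h1 : e (φ.symm (y, 0)) = 0 := by rw [h]; rfl
      rw [e_apply] at h1
      have h2 : φ (φ.symm (y, 0)) = (y, 0) := LinearEquiv.apply_symm_apply φ _
      rw [h2] at h1
      exact congrArg Prod.fst ((LinearEquiv.map_eq_zero_iff φ.symm).1 h1)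
    rw [key a, key b]
  · refine hZ ⟨fun a b => ?_⟩
    have key : ∀ z : Z.V, z = 0 := fun z => by
      have h1 : e (φ.symm (0, z)) = φ.symm (0, z) := by rw [h]; rfl
      rw [e_apply] at h1
      have h2 : φ (φ.symm (0, z)) = (0, z) := LinearEquiv.apply_symm_apply φ _
      rw [h2] at h1
      exact (congrArg Prod.snd (φ.symm.injective h1)).symm
    rw [key a, key b]

/-! ### The nilpotent Jordan block and its commuting idempotents -/

section Shift

variable (k) (f : ℕ)

/-- The nilpotent Jordan block of size `f`. -/
def jordan : (Fin f → k) →ₗ[k] (Fin f → k) where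
  toFun v i := if h : i.1 + 1 < f then v ⟨i.1 + 1, h⟩ else 0
  map_add' v w := by ext i; by_cases h : i.1 + 1 < f <;> simp [h]
  map_smul' c v := by ext i; by_cases h : i.1 + 1 < f <;> simp [h]

variable {k f}

theorem jordan_apply_of_lt (v : Fin f → k) (i : ℕ) (h : i + 1 < f) :
    jordan k f v ⟨i, by omega⟩ = v ⟨i + 1, h⟩ := by
  simp [jordan, h]

theorem jordan_iterate_eq_zero (v : Fin f → k) (m : ℕ) (i : Fin f) (h : f ≤ i.1 + m) :
    (jordan k f ^ m) v i = 0 := by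
  induction m generalizing i with
  | zero => omega
  | succ m ih =>
    rw [pow_succ', Module.End.mul_apply]
    change (if h : i.1 + 1 < f then ((jordan k f ^ m) v) ⟨i.1 + 1, h⟩ else 0) = 0
    split_ifs with h'
    · exact ih _ (by simp only; omega)
    · rfl

theorem jordan_pow_eq_zero : jordan k f ^ f = 0 := by
  ext v i
  exact jordan_iterate_eq_zero _ _ _ (by omega)

/-- The kernel of the Jordan block is the line of the first basis vector, so coordinate `0` detects
it. -/
theorem eq_zero_of_jordan_eq_zero {v : Fin f → k} (h : jordan k f v = 0) (hf : 0 < f)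
    (h0 : v ⟨0, hf⟩ = 0) : v = 0 := by
  ext ⟨i, hi⟩
  cases i with
  | zero => exact h0
  | succ i => rw [← jordan_apply_of_lt v i hi, h]; rfl

/-- A non-zero subspace stable under a nilpotent operator meets its kernel. -/
theorem eq_zero_of_nilpotent {W : Type u} [AddCommGroup W] [Module k W] {N : W →ₗ[k] W} {m : ℕ}
    (hN : N ^ m = 0) (S : Set W) (hS : ∀ x ∈ S, N x ∈ S)
    (hker : ∀ x ∈ S, N x = 0 → x = 0) : ∀ x ∈ S, x = 0 := by
  have key : ∀ j : ℕ, ∀ x ∈ S, (N ^ j) x = 0 → x = 0 := by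
    intro j
    induction j with
    | zero => intro x _ h; simpa using h
    | succ j ih =>
      intro x hx h
      rw [pow_succ, Module.End.mul_apply] at h
      exact hker x hx (ih _ (hS x hx) h)
  exact fun x hx => key m x hx (by rw [hN]; rfl)

/-- The Jordan block commutes with no idempotents other than `0` and `1`. -/
theorem idempotent_commute_jordan (hf : 0 < f) (P : (Fin f → k) →ₗ[k] (Fin f → k))
    (hP : ∀ v, P (P v) = P v) (hc : ∀ v, P (jordan k f v) = jordan k f (P v)) :
    P = 0 ∨ P = LinearMap.id := by
  by_contra hcon
  have exists_ker : ∀ S : Set (Fin f → k), (∀ x ∈ S, jordan k f x ∈ S) →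
      (∃ x ∈ S, x ≠ 0) → ∃ x ∈ S, jordan k f x = 0 ∧ x ≠ 0 := by
    rintro S hS ⟨x, hx, hx0⟩
    by_contra hn
    push Not at hn
    exact hx0 (eq_zero_of_nilpotent jordan_pow_eq_zero S hS hn x hx)
  rw [not_or] at hcon
  -- If `P` is neither `0` nor `1`, its image and its kernel are both non-zero and stable under the
  -- Jordan block, so each contains a non-zero vector of the one-dimensional kernel of the block.
  obtain ⟨x, hx, hxj, hx0⟩ := exists_ker {x | P x = x}
    (fun x hx => by change P _ = _; rw [hc, show P x = x from hx]) (by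
      by_contra hn
      push Not at hn
      exact hcon.1 (LinearMap.ext fun v => hn (P v) (hP v)))
  obtain ⟨y, hy, hyj, hy0⟩ := exists_ker {x | P x = 0}
    (fun x hx => by change P _ = _; rw [hc, show P x = 0 from hx, map_zero]) (by
      by_contra hn
      push Not at hn
      refine hcon.2 (LinearMap.ext fun v => ?_)
      exact (sub_eq_zero.1 (hn (v - P v) (by
        change P (v - P v) = 0
        rw [map_sub, hP, sub_self]))).symm)
  change P x = x at hx
  change P y = 0 at hy
  -- The coefficients cancel coordinate `0`; applying `P` then removes `y`.
  have hxy : y ⟨0, hf⟩ • x - x ⟨0, hf⟩ • y = 0 := by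
    refine eq_zero_of_jordan_eq_zero (by rw [map_sub, map_smul, map_smul, hxj, hyj]; simp) hf ?_
    simp [mul_comm]
  have h1 := congrArg P hxy
  rw [map_sub, map_smul, map_smul, hx, hy, smul_zero, sub_zero, map_zero] at h1
  rcases smul_eq_zero.1 h1 with h2 | h2
  · exact hy0 (eq_zero_of_jordan_eq_zero hyj hf h2)
  · exact hx0 h2

end Shift

/-! ### Operators commuting with the three-column shift -/

section Columns

variable {M : Type u} [AddCommGroup M] [Module k M]

variable (k M) in
/-- The nilpotent operator on `M ^ 13` with columns of lengths `7`, `4` and `2`, occupying the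
coordinates `0, …, 6`, `7, …, 10` and `11, 12`. -/
def columnShift : (Fin 13 → M) →ₗ[k] (Fin 13 → M) where
  toFun v := ![v 1, v 2, v 3, v 4, v 5, v 6, 0, v 8, v 9, v 10, 0, v 12, 0]
  map_add' v w := by ext i; fin_cases i <;> simp
  map_smul' c v := by ext i; fin_cases i <;> simp

theorem columnShift_apply (v : Fin 13 → M) :
    columnShift k M v = ![v 1, v 2, v 3, v 4, v 5, v 6, 0, v 8, v 9, v 10, 0, v 12, 0] := rfl

theorem columnShift_pow_seven : columnShift k M ^ 7 = 0 := by
  have h2 : ∀ v : Fin 13 → M, (columnShift k M ^ 2) v =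
      ![v 2, v 3, v 4, v 5, v 6, 0, 0, v 9, v 10, 0, 0, 0, 0] := fun v => rfl
  have h4 : ∀ v : Fin 13 → M, (columnShift k M ^ 4) v =
      ![v 4, v 5, v 6, 0, 0, 0, 0, 0, 0, 0, 0, 0, 0] := fun v => by
    rw [show 4 = 2 + 2 from rfl, pow_add, Module.End.mul_apply, h2, h2]
    rfl
  refine LinearMap.ext fun v => ?_
  rw [show 7 = 4 + (2 + 1) from rfl, pow_add, pow_add, pow_one, Module.End.mul_apply,
    Module.End.mul_apply, h4, h2, columnShift_apply]
  ext i
  fin_cases i <;> rfl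

/-- The entry of an operator on `M ^ 13` in row `i` and column `j`. -/
def entry (g : (Fin 13 → M) →ₗ[k] (Fin 13 → M)) (i j : Fin 13) : M →ₗ[k] M :=
  LinearMap.proj i ∘ₗ g ∘ₗ LinearMap.single k (fun _ => M) j

theorem entry_apply (g : (Fin 13 → M) →ₗ[k] (Fin 13 → M)) (i j : Fin 13) (w : M) :
    g (Pi.single j w) i = entry g i j w := rfl

theorem columnShift_single_succ (j j' : Fin 13)
    (h : (j, j') ∈ [(0, 1), (1, 2), (2, 3), (3, 4), (4, 5), (5, 6), (7, 8), (8, 9), (9, 10),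
      ((11, 12) : Fin 13 × Fin 13)]) (w : M) :
    columnShift k M (Pi.single j' w) = Pi.single j w := by
  rw [columnShift_apply]
  simp only [List.mem_cons, Prod.mk.injEq, List.not_mem_nil, or_false] at h
  rcases h with h | h | h | h | h | h | h | h | h | h <;> obtain ⟨rfl, rfl⟩ := h <;>
    (ext i; fin_cases i <;> rfl)

theorem columnShift_single_bottom (j : Fin 13) (h : j ∈ [0, 7, (11 : Fin 13)]) (w : M) :
    columnShift k M (Pi.single j w) = 0 := by
  rw [columnShift_apply]
  simp only [List.mem_cons, List.not_mem_nil, or_false] at h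
  rcases h with rfl | rfl | rfl <;> (ext i; fin_cases i <;> rfl)

section Entries

variable {g : (Fin 13 → M) →ₗ[k] (Fin 13 → M)}

theorem entry_shift (hg : ∀ v, g (columnShift k M v) = columnShift k M (g v)) (i j i' j' : Fin 13)
    (hj : (j, j') ∈ [(0, 1), (1, 2), (2, 3), (3, 4), (4, 5), (5, 6), (7, 8), (8, 9), (9, 10),
      ((11, 12) : Fin 13 × Fin 13)])
    (hi : ∀ v : Fin 13 → M, columnShift k M v i = v i') :
    entry g i j = entry g i' j' := by
  ext w
  rw [← entry_apply, ← entry_apply, ← columnShift_single_succ (k := k) j j' hj, hg, hi]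

theorem entry_eq_zero_of_top (hg : ∀ v, g (columnShift k M v) = columnShift k M (g v))
    (i j j' : Fin 13)
    (hj : (j, j') ∈ [(0, 1), (1, 2), (2, 3), (3, 4), (4, 5), (5, 6), (7, 8), (8, 9), (9, 10),
      ((11, 12) : Fin 13 × Fin 13)])
    (hi : ∀ v : Fin 13 → M, columnShift k M v i = 0) :
    entry g i j = 0 := by
  ext w
  rw [← entry_apply, ← columnShift_single_succ (k := k) j j' hj, hg, hi]
  rfl

theorem entry_eq_zero_of_bottom (hg : ∀ v, g (columnShift k M v) = columnShift k M (g v))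
    (i i' j : Fin 13) (hj : j ∈ [0, 7, (11 : Fin 13)])
    (hi : ∀ v : Fin 13 → M, columnShift k M v i' = v i) :
    entry g i j = 0 := by
  ext w
  rw [← entry_apply, ← hi (g _), ← hg, columnShift_single_bottom j hj, map_zero]
  rfl

/-- The homogeneous entries off the diagonal vanish, as the three columns are strictly nested. -/
theorem entry_cross_eq_zero (hg : ∀ v, g (columnShift k M v) = columnShift k M (g v)) :
    entry g 7 0 = 0 ∧ entry g 11 0 = 0 ∧ entry g 11 7 = 0 ∧
    (entry g 9 3 = 0 ∧ entry g 8 2 = 0 ∧ entry g 9 4 = 0) ∧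
    (entry g 12 3 = 0 ∧ entry g 11 2 = 0 ∧ entry g 12 4 = 0) ∧
    (entry g 12 9 = 0 ∧ entry g 11 8 = 0) ∧
    (entry g 2 8 = 0 ∧ entry g 3 9 = 0 ∧ entry g 3 8 = 0 ∧ entry g 4 9 = 0) ∧
    (entry g 2 11 = 0 ∧ entry g 3 12 = 0 ∧ entry g 3 11 = 0 ∧ entry g 4 12 = 0) ∧
    (entry g 8 11 = 0 ∧ entry g 9 12 = 0) := by
  have t : ∀ i j j', _ → _ → entry g i j = 0 := entry_eq_zero_of_top hg
  have s : ∀ i j i' j', _ → _ → entry g i j = entry g i' j' := entry_shift hg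
  have b : ∀ i i' j, _ → _ → entry g i j = 0 := entry_eq_zero_of_bottom hg
  -- From a longer to a shorter column: the top row of the shorter column vanishes on everything in
  -- the image of the shift, and the zeros spread down the diagonals.
  have h10_4 := t 10 4 5 (by decide) fun _ => rfl
  have h10_5 := t 10 5 6 (by decide) fun _ => rfl
  have h10_3 := t 10 3 4 (by decide) fun _ => rfl
  have h9_3 := (s 9 3 10 4 (by decide) fun _ => rfl).trans h10_4
  have h9_4 := (s 9 4 10 5 (by decide) fun _ => rfl).trans h10_5
  have h9_2 := (s 9 2 10 3 (by decide) fun _ => rfl).trans h10_3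
  have h8_2 := (s 8 2 9 3 (by decide) fun _ => rfl).trans h9_3
  have h8_1 := (s 8 1 9 2 (by decide) fun _ => rfl).trans h9_2
  have h7_0 := (s 7 0 8 1 (by decide) fun _ => rfl).trans h8_1
  have h12_1 := t 12 1 2 (by decide) fun _ => rfl
  have h12_3 := t 12 3 4 (by decide) fun _ => rfl
  have h12_4 := t 12 4 5 (by decide) fun _ => rfl
  have h12_8 := t 12 8 9 (by decide) fun _ => rfl
  have h12_9 := t 12 9 10 (by decide) fun _ => rfl
  have h11_0 := (s 11 0 12 1 (by decide) fun _ => rfl).trans h12_1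
  have h11_2 := (s 11 2 12 3 (by decide) fun _ => rfl).trans h12_3
  have h11_7 := (s 11 7 12 8 (by decide) fun _ => rfl).trans h12_8
  have h11_8 := (s 11 8 12 9 (by decide) fun _ => rfl).trans h12_9
  -- From a shorter to a longer column: the bottom of the shorter one is killed by the shift, so its
  -- image has no component above the bottom of the longer one. These zeros spread up the diagonals.
  have h1_7 := b 1 0 7 (by decide) fun _ => rfl
  have h2_7 := b 2 1 7 (by decide) fun _ => rfl
  have h2_8 := (s 1 7 2 8 (by decide) fun _ => rfl).symm.trans h1_7
  have h3_8 := (s 2 7 3 8 (by decide) fun _ => rfl).symm.trans h2_7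
  have h3_9 := (s 2 8 3 9 (by decide) fun _ => rfl).symm.trans h2_8
  have h4_9 := (s 3 8 4 9 (by decide) fun _ => rfl).symm.trans h3_8
  have h2_11 := b 2 1 11 (by decide) fun _ => rfl
  have h3_11 := b 3 2 11 (by decide) fun _ => rfl
  have h3_12 := (s 2 11 3 12 (by decide) fun _ => rfl).symm.trans h2_11
  have h4_12 := (s 3 11 4 12 (by decide) fun _ => rfl).symm.trans h3_11
  have h8_11 := b 8 7 11 (by decide) fun _ => rfl
  have h9_12 := (s 8 11 9 12 (by decide) fun _ => rfl).symm.trans h8_11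
  exact ⟨h7_0, h11_0, h11_7, ⟨h9_3, h8_2, h9_4⟩, ⟨h12_3, h11_2, h12_4⟩, ⟨h12_9, h11_8⟩,
    ⟨h2_8, h3_9, h3_8, h4_9⟩, ⟨h2_11, h3_12, h3_11, h4_12⟩, ⟨h8_11, h9_12⟩⟩

/-- The diagonal entries are constant along each column. -/
theorem entry_diag (hg : ∀ v, g (columnShift k M v) = columnShift k M (g v)) :
    (entry g 2 2 = entry g 0 0 ∧ entry g 3 3 = entry g 0 0 ∧ entry g 4 4 = entry g 0 0) ∧
    (entry g 8 8 = entry g 7 7 ∧ entry g 9 9 = entry g 7 7) ∧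
    entry g 12 12 = entry g 11 11 := by
  have s : ∀ i j i' j', _ → _ → entry g i j = entry g i' j' := entry_shift hg
  have h1 := s 0 0 1 1 (by decide) fun _ => rfl
  have h2 := s 1 1 2 2 (by decide) fun _ => rfl
  have h3 := s 2 2 3 3 (by decide) fun _ => rfl
  have h4 := s 3 3 4 4 (by decide) fun _ => rfl
  have h8 := s 7 7 8 8 (by decide) fun _ => rfl
  have h9 := s 8 8 9 9 (by decide) fun _ => rfl
  have h12 := s 11 11 12 12 (by decide) fun _ => rfl
  simp only [h1, h2, h3, h4, h8, h9, h12, and_self]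

theorem eq_of_columnShift_eq_zero {v : Fin 13 → M} (h : columnShift k M v = 0) :
    v = Pi.single 0 (v 0) + Pi.single 7 (v 7) + Pi.single 11 (v 11) := by
  have h' : ∀ i, columnShift k M v i = 0 := fun i => by rw [h]; rfl
  have h1 : v 1 = 0 := h' 0
  have h2 : v 2 = 0 := h' 1
  have h3 : v 3 = 0 := h' 2
  have h4 : v 4 = 0 := h' 3
  have h5 : v 5 = 0 := h' 4
  have h6 : v 6 = 0 := h' 5
  have h8 : v 8 = 0 := h' 7
  have h9 : v 9 = 0 := h' 8
  have h10 : v 10 = 0 := h' 9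
  have h12 : v 12 = 0 := h' 11
  ext i
  fin_cases i <;> simp [h1, h2, h3, h4, h5, h6, h8, h9, h10, h12]

/-- An idempotent commuting with the shift vanishes if its diagonal entries do. -/
theorem eq_zero_of_diag_eq_zero (hg : ∀ v, g (columnShift k M v) = columnShift k M (g v))
    (hidem : ∀ v, g (g v) = g v) (h0 : entry g 0 0 = 0) (h7 : entry g 7 7 = 0)
    (h11 : entry g 11 11 = 0) : g = 0 := by
  obtain ⟨c1, c2, c3, -⟩ := entry_cross_eq_zero hg
  have key : ∀ v ∈ {v | g v = v}, v = 0 := by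
    refine eq_zero_of_nilpotent (columnShift_pow_seven (k := k) (M := M)) _ (fun v hv => ?_)
      (fun v hv hv0 => ?_)
    · change g _ = _
      rw [hg, show g v = v from hv]
    · change g v = v at hv
      have hs := eq_of_columnShift_eq_zero hv0
      have comp : ∀ i, entry g i 0 (v 0) + entry g i 7 (v 7) + entry g i 11 (v 11) = v i := by
        intro i
        rw [← entry_apply, ← entry_apply, ← entry_apply, ← Pi.add_apply, ← Pi.add_apply,
          ← map_add, ← map_add, ← hs, hv]
      -- On the kernel of the shift, `g` is block upper triangular for the order 0, 7, 11. With zero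
      -- diagonal it fixes no non-zero vector, as the rows read from the last one show.
      have e11 := comp 11
      rw [c2, c3, h11] at e11
      have e7 := comp 7
      rw [c1, h7, ← e11] at e7
      have e0 := comp 0
      simp only [LinearMap.zero_apply, add_zero, map_zero] at e11 e7
      rw [h0, ← e11, ← e7] at e0
      simp only [LinearMap.zero_apply, add_zero, map_zero] at e0
      rw [hs, ← e0, ← e7, ← e11]
      simp
  exact LinearMap.ext fun v => key (g v) (hidem v)

/-- Maps from the longest column to the shorter ones kill its bottom, and `g` preserves the kernel
of the shift. So `g` maps the bottom of the longest column to itself, acting by this entry alone. -/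
theorem entry_zero_zero_idempotent (hg : ∀ v, g (columnShift k M v) = columnShift k M (g v))
    (hidem : ∀ v, g (g v) = g v) (w : M) : entry g 0 0 (entry g 0 0 w) = entry g 0 0 w := by
  obtain ⟨c1, c2, -⟩ := entry_cross_eq_zero hg
  have h : columnShift k M (g (Pi.single 0 w)) = 0 := by
    rw [← hg, columnShift_single_bottom 0 (by decide), map_zero]
  have hs := eq_of_columnShift_eq_zero h
  rw [entry_apply, entry_apply, entry_apply, c1, c2] at hs
  simp only [LinearMap.zero_apply, Pi.single_zero, add_zero] at hs
  rw [← entry_apply g 0 0 (entry g 0 0 w), ← hs, hidem, entry_apply]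

end Entries

end Columns

/-! ### The two families of triples -/

section Families

variable {f : ℕ}

/-- An idempotent commuting with the shift is `0` or `1` if its diagonal entries agree and
commute with the Jordan block. -/
theorem eq_zero_or_id {g : (Fin 13 → Fin f → k) →ₗ[k] (Fin 13 → Fin f → k)} (hf : 0 < f)
    (hg : ∀ v, g (columnShift k (Fin f → k) v) = columnShift k (Fin f → k) (g v))
    (hidem : ∀ v, g (g v) = g v)
    (h7 : entry g 7 7 = entry g 0 0) (h11 : entry g 11 11 = entry g 0 0)
    (hc : ∀ w, entry g 0 0 (jordan k f w) = jordan k f (entry g 0 0 w)) :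
    g = 0 ∨ g = LinearMap.id := by
  rcases idempotent_commute_jordan hf _ (entry_zero_zero_idempotent hg hidem) hc with h | h
  · exact Or.inl (eq_zero_of_diag_eq_zero hg hidem h (h7.trans h) (h11.trans h))
  · right
    -- The case of diagonal `1` reduces to that of diagonal `0` by passing to the complementary
    -- idempotent.
    have hd : ∀ i, entry g i i = LinearMap.id → entry (LinearMap.id - g) i i = 0 := by
      intro i hi
      refine LinearMap.ext fun w => ?_
      have h1 : entry (LinearMap.id - g) i i w = (Pi.single i w : Fin 13 → Fin f → k) i -
        entry g i i w := rfl
      rw [h1, hi, Pi.single_eq_same, LinearMap.id_apply, sub_self, LinearMap.zero_apply]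
    have hz : LinearMap.id - g = 0 := by
      refine eq_zero_of_diag_eq_zero (fun v => ?_) (fun v => ?_) (hd _ h) (hd _ (h7.trans h))
        (hd _ (h11.trans h))
      · simp [hg]
      · simp [hidem]
    exact (sub_eq_zero.1 hz).symm

variable (k f) in
/-- The subspace of total dimension `6 f`; the columns are placed so that the coordinates
`3, 9, 12` share a degree. -/
def lowerSubspace : Submodule k (Fin 13 → Fin f → k) where
  carrier := {v | v 4 = 0 ∧ v 5 = 0 ∧ v 6 = 0 ∧ v 10 = 0 ∧ v 9 = v 3 ∧ v 12 = v 3 ∧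
    v 11 = v 2 + jordan k f (v 8 - v 2)}
  zero_mem' := by simp
  add_mem' := by
    rintro v w ⟨h1, h2, h3, h4, h5, h6, h7⟩ ⟨l1, l2, l3, l4, l5, l6, l7⟩
    refine ⟨?_, ?_, ?_, ?_, ?_, ?_, ?_⟩ <;> simp only [Pi.add_apply, *, add_zero]
    rw [← add_add_add_comm, ← map_add, sub_add_sub_comm]
  smul_mem' := by
    rintro c v ⟨h1, h2, h3, h4, h5, h6, h7⟩
    refine ⟨?_, ?_, ?_, ?_, ?_, ?_, ?_⟩ <;> simp only [Pi.smul_apply, *, smul_zero]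
    rw [smul_add, ← map_smul, smul_sub]

variable (k f) in
/-- The subspace of total dimension `7 f`; the columns are placed so that the coordinates
`4, 9, 12` share a degree. -/
def upperSubspace : Submodule k (Fin 13 → Fin f → k) where
  carrier := {v | v 5 = 0 ∧ v 6 = 0 ∧ v 10 = 0 ∧ v 9 = v 4 ∧ v 12 = v 4 ∧
    v 11 = v 3 + jordan k f (v 8 - v 3)}
  zero_mem' := by simp
  add_mem' := by
    rintro v w ⟨h2, h3, h4, h5, h6, h7⟩ ⟨l2, l3, l4, l5, l6, l7⟩
    refine ⟨?_, ?_, ?_, ?_, ?_, ?_⟩ <;> simp only [Pi.add_apply, *, add_zero]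
    rw [← add_add_add_comm, ← map_add, sub_add_sub_comm]
  smul_mem' := by
    rintro c v ⟨h2, h3, h4, h5, h6, h7⟩
    refine ⟨?_, ?_, ?_, ?_, ?_, ?_⟩ <;> simp only [Pi.smul_apply, *, smul_zero]
    rw [smul_add, ← map_smul, smul_sub]

variable (k f) in
/-- Six free coordinates parametrize `lowerSubspace`. -/
def lowerEquiv : lowerSubspace k f ≃ₗ[k] (Fin 6 → Fin f → k) where
  toFun v := ![v.1 0, v.1 1, v.1 2, v.1 3, v.1 7, v.1 8]
  map_add' v w := by ext i; fin_cases i <;> simp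
  map_smul' c v := by ext i; fin_cases i <;> simp
  invFun a := ⟨![a 0, a 1, a 2, a 3, 0, 0, 0, a 4, a 5, a 3, 0, a 2 + jordan k f (a 5 - a 2), a 3],
    rfl, rfl, rfl, rfl, rfl, rfl, rfl⟩
  left_inv := by
    rintro ⟨v, h1, h2, h3, h4, h5, h6, h7⟩
    refine Subtype.ext (funext fun i => ?_)
    fin_cases i <;>
      first | rfl | exact h1.symm | exact h2.symm | exact h3.symm | exact h4.symm | exact h5.symm |
        exact h6.symm | exact h7.symm
  right_inv a := by
    refine funext fun i => ?_
    fin_cases i <;> rfl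

variable (k f) in
/-- Seven free coordinates parametrize `upperSubspace`. -/
def upperEquiv : upperSubspace k f ≃ₗ[k] (Fin 7 → Fin f → k) where
  toFun v := ![v.1 0, v.1 1, v.1 2, v.1 3, v.1 4, v.1 7, v.1 8]
  map_add' v w := by ext i; fin_cases i <;> simp
  map_smul' c v := by ext i; fin_cases i <;> simp
  invFun a := ⟨![a 0, a 1, a 2, a 3, a 4, 0, 0, a 5, a 6, a 4, 0, a 3 + jordan k f (a 6 - a 3),
    a 4], rfl, rfl, rfl, rfl, rfl, rfl⟩
  left_inv := by
    rintro ⟨v, h2, h3, h4, h5, h6, h7⟩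
    refine Subtype.ext (funext fun i => ?_)
    fin_cases i <;>
      first | rfl | exact h2.symm | exact h3.symm | exact h4.symm | exact h5.symm |
        exact h6.symm | exact h7.symm
  right_inv a := by
    refine funext fun i => ?_
    fin_cases i <;> rfl

variable (k f) in
/-- The triple of dimension pair `f (13, 6)`. -/
def lowerTriple (hn : 7 ≤ n) : Triple k n where
  V := Fin 13 → Fin f → k
  T := columnShift k _
  U := lowerSubspace k f
  pow_eq_zero := pow_eq_zero_of_le hn columnShift_pow_seven
  invariant := by
    rintro v ⟨h1, h2, h3, h4, h5, h6, h7⟩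
    refine ⟨h2, h3, rfl, rfl, h4.trans h1.symm, h1.symm, ?_⟩
    -- One degree down, the Jordan term vanishes: the shift carries the diagonal to the diagonal.
    change v 12 = v 3 + jordan k f (v 9 - v 3)
    rw [h5, h6, sub_self, map_zero, add_zero]

variable (k f) in
/-- The triple of dimension pair `f (13, 7)`. -/
def upperTriple (hn : 7 ≤ n) : Triple k n where
  V := Fin 13 → Fin f → k
  T := columnShift k _
  U := upperSubspace k f
  pow_eq_zero := pow_eq_zero_of_le hn columnShift_pow_seven
  invariant := by
    rintro v ⟨h2, h3, h4, h5, h6, h7⟩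
    refine ⟨h3, rfl, rfl, h4.trans h2.symm, h2.symm, ?_⟩
    change v 12 = v 4 + jordan k f (v 9 - v 4)
    rw [h5, h6, sub_self, map_zero, add_zero]

theorem dimPair_lowerTriple (hn : 7 ≤ n) : dimPair (lowerTriple k f hn) = (f * 13, f * 6) := by
  have h1 : Module.finrank k (Fin 13 → Fin f → k) = f * 13 := by
    simp [Module.finrank_pi_fintype, mul_comm]
  have h2 : Module.finrank k (lowerSubspace k f) = f * 6 := by
    rw [(lowerEquiv k f).finrank_eq]
    simp [Module.finrank_pi_fintype, mul_comm]
  exact Prod.ext h1 h2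

theorem dimPair_upperTriple (hn : 7 ≤ n) : dimPair (upperTriple k f hn) = (f * 13, f * 7) := by
  have h1 : Module.finrank k (Fin 13 → Fin f → k) = f * 13 := by
    simp [Module.finrank_pi_fintype, mul_comm]
  have h2 : Module.finrank k (upperSubspace k f) = f * 7 := by
    rw [(upperEquiv k f).finrank_eq]
    simp [Module.finrank_pi_fintype, mul_comm]
  exact Prod.ext h1 h2

theorem not_subsingleton_columns (hf : 0 < f) : ¬ Subsingleton (Fin 13 → Fin f → k) := fun h =>
  one_ne_zero (congrFun (congrFun (h.elim (1 : Fin 13 → Fin f → k) 0) 0) ⟨0, hf⟩)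

theorem indecomposable_lowerTriple (hn : 7 ≤ n) (hf : 0 < f) :
    Indecomposable (lowerTriple k f hn) := by
  refine indecomposable_of_idempotent (not_subsingleton_columns hf) ?_
  change ∀ g : (Fin 13 → Fin f → k) →ₗ[k] (Fin 13 → Fin f → k), _
  rintro g ⟨hU, hg⟩ hidem
  change ∀ v, g (columnShift k _ v) = columnShift k _ (g v) at hg
  change ∀ v ∈ lowerSubspace k f, g v ∈ lowerSubspace k f at hU
  change ∀ v, g (g v) = g v at hidem
  obtain ⟨-, -, -, ⟨h9_3, -, -⟩, ⟨h12_3, -, -⟩, ⟨h12_9, h11_8⟩, ⟨h2_8, h3_9, -, -⟩,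
    ⟨h2_11, h3_12, -, -⟩, ⟨h8_11, h9_12⟩⟩ := entry_cross_eq_zero hg
  obtain ⟨⟨d2, d3, -⟩, ⟨d8, d9⟩, d12⟩ := entry_diag hg
  have hu : ∀ w : Fin f → k, entry g 7 7 w = entry g 0 0 w ∧ entry g 11 11 w = entry g 0 0 w := by
    intro w
    -- A diagonal vector in the degree of 3, 9, 12. Its image must have equal entries there, so the
    -- three diagonal operators agree.
    have hw : (Pi.single 3 w + Pi.single 9 w + Pi.single 12 w : Fin 13 → Fin f → k) ∈
        lowerSubspace k f := by
      refine ⟨?_, ?_, ?_, ?_, ?_, ?_, ?_⟩ <;> simp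
    obtain ⟨-, -, -, -, l5, l6, -⟩ := hU _ hw
    simp only [map_add, Pi.add_apply, entry_apply, h9_3, h9_12, d9, h3_9, h3_12, d3, h12_3, h12_9,
      d12, LinearMap.zero_apply, zero_add, add_zero] at l5 l6
    exact ⟨l5, l6⟩
  have h7 : entry g 7 7 = entry g 0 0 := LinearMap.ext fun w => (hu w).1
  have h11 : entry g 11 11 = entry g 0 0 := LinearMap.ext fun w => (hu w).2
  refine eq_zero_or_id hf hg hidem h7 h11 fun w => ?_
  -- A vector of the graph of the Jordan block, one degree lower. The relation for coordinate 11
  -- becomes the commutation with the block.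
  have hw : (Pi.single 8 w + Pi.single 11 (jordan k f w) : Fin 13 → Fin f → k) ∈
      lowerSubspace k f := by
    refine ⟨?_, ?_, ?_, ?_, ?_, ?_, ?_⟩ <;> simp
  obtain ⟨-, -, -, -, -, -, l7⟩ := hU _ hw
  simpa only [map_add, Pi.add_apply, entry_apply, h11_8, h11, h2_8, h2_11, d8, h7, h8_11,
    LinearMap.zero_apply, zero_add, add_zero, sub_zero] using l7

theorem indecomposable_upperTriple (hn : 7 ≤ n) (hf : 0 < f) :
    Indecomposable (upperTriple k f hn) := by
  refine indecomposable_of_idempotent (not_subsingleton_columns hf) ?_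
  change ∀ g : (Fin 13 → Fin f → k) →ₗ[k] (Fin 13 → Fin f → k), _
  rintro g ⟨hU, hg⟩ hidem
  change ∀ v, g (columnShift k _ v) = columnShift k _ (g v) at hg
  change ∀ v ∈ upperSubspace k f, g v ∈ upperSubspace k f at hU
  change ∀ v, g (g v) = g v at hidem
  obtain ⟨-, -, -, ⟨-, -, h9_4⟩, ⟨-, -, h12_4⟩, ⟨h12_9, h11_8⟩, ⟨-, -, h3_8, h4_9⟩,
    ⟨-, -, h3_11, h4_12⟩, ⟨h8_11, h9_12⟩⟩ := entry_cross_eq_zero hg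
  obtain ⟨⟨-, d3, d4⟩, ⟨d8, d9⟩, d12⟩ := entry_diag hg
  have hu : ∀ w : Fin f → k, entry g 7 7 w = entry g 0 0 w ∧ entry g 11 11 w = entry g 0 0 w := by
    intro w
    -- The same two test vectors serve here, with the long column now meeting the short ones at 4
    -- and 3 instead of 3 and 2.
    have hw : (Pi.single 4 w + Pi.single 9 w + Pi.single 12 w : Fin 13 → Fin f → k) ∈
        upperSubspace k f := by
      refine ⟨?_, ?_, ?_, ?_, ?_, ?_⟩ <;> simp
    obtain ⟨-, -, -, l5, l6, -⟩ := hU _ hw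
    simp only [map_add, Pi.add_apply, entry_apply, h9_4, h9_12, d9, h4_9, h4_12, d4, h12_4, h12_9,
      d12, LinearMap.zero_apply, zero_add, add_zero] at l5 l6
    exact ⟨l5, l6⟩
  have h7 : entry g 7 7 = entry g 0 0 := LinearMap.ext fun w => (hu w).1
  have h11 : entry g 11 11 = entry g 0 0 := LinearMap.ext fun w => (hu w).2
  refine eq_zero_or_id hf hg hidem h7 h11 fun w => ?_
  have hw : (Pi.single 8 w + Pi.single 11 (jordan k f w) : Fin 13 → Fin f → k) ∈
      upperSubspace k f := by
    refine ⟨?_, ?_, ?_, ?_, ?_, ?_⟩ <;> simp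
  obtain ⟨-, -, -, -, -, l7⟩ := hU _ hw
  simpa only [map_add, Pi.add_apply, entry_apply, h11_8, h11, h3_8, h3_11, d8, h7, h8_11,
    LinearMap.zero_apply, zero_add, add_zero, sub_zero] using l7

end Families

end NilpotentTriples

/-! ### Strips and the main theorem -/

/-- A real number whose positive integer multiples are bounded is zero. -/
theorem eq_zero_of_forall_mul_mem_Icc {x c d : ℝ}
    (h : ∀ f : ℕ, 0 < f → c ≤ f * x ∧ f * x ≤ d) : x = 0 := by
  by_contra hx
  obtain ⟨m, hm⟩ := exists_nat_gt ((|c| + |d|) / |x|)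
  have hx' : 0 < |x| := abs_pos.2 hx
  rw [div_lt_iff₀ hx'] at hm
  obtain ⟨h1, h2⟩ := h (m + 1) m.succ_pos
  have h3 : |((m + 1 : ℕ) : ℝ) * x| ≤ |c| + |d| := by
    rw [abs_le]
    constructor
    · linarith [neg_abs_le c, abs_nonneg d]
    · linarith [le_abs_self d, abs_nonneg c]
  rw [abs_mul, Nat.abs_cast] at h3
  push_cast at h3
  linarith

theorem mainTheorem12 (k : Type u) [Field k] :
    (∀ n : ℕ, 7 ≤ n → ∀ S : Set (ℝ × ℝ), IsStrip S →
      ¬ ∀ X : NilpotentTriples.Triple k n, NilpotentTriples.Indecomposable X →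
        (((NilpotentTriples.dimPair X).1 : ℝ), ((NilpotentTriples.dimPair X).2 : ℝ)) ∈ S) ∧
    (∀ f : ℕ, 0 < f →
      (∃ X : NilpotentTriples.Triple k 7, NilpotentTriples.Indecomposable X ∧
        NilpotentTriples.dimPair X = (f * 13, f * 6)) ∧
      (∃ X : NilpotentTriples.Triple k 7, NilpotentTriples.Indecomposable X ∧
        NilpotentTriples.dimPair X = (f * 13, f * 7))) := by
  refine ⟨?_, fun f hf => ⟨⟨_, NilpotentTriples.indecomposable_lowerTriple le_rfl hf,
    NilpotentTriples.dimPair_lowerTriple le_rfl⟩, ⟨_,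
    NilpotentTriples.indecomposable_upperTriple le_rfl hf,
    NilpotentTriples.dimPair_upperTriple le_rfl⟩⟩⟩
  rintro n hn S ⟨a, b, c, d, hab, rfl⟩ hS
  have h6 : 13 * a + 6 * b = 0 := eq_zero_of_forall_mul_mem_Icc (c := c) (d := d) fun f hf => by
    have h := hS _ (NilpotentTriples.indecomposable_lowerTriple (k := k) hn hf)
    rw [NilpotentTriples.dimPair_lowerTriple] at h
    obtain ⟨h1, h2⟩ := h
    push_cast at h1 h2
    constructor <;> linarith
  have h7 : 13 * a + 7 * b = 0 := eq_zero_of_forall_mul_mem_Icc (c := c) (d := d) fun f hf => by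
    have h := hS _ (NilpotentTriples.indecomposable_upperTriple (k := k) hn hf)
    rw [NilpotentTriples.dimPair_upperTriple] at h
    obtain ⟨h1, h2⟩ := h
    push_cast at h1 h2
    constructor <;> linarith
  have hb : b = 0 := by linarith
  have ha : a = 0 := by linarith
  exact hab (by rw [ha, hb])
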